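/- Suppose that $m$ drivers arrive one after another at a car park whose $n$ spaces are numbered $1,\dots,n$ in a line. Driver $i$ has a preferred space $f(i)\in\{1,\dots,n\}$; he parks in the first free space with number at least $f(i)$, and if there is no such space he leaves, that is, he fails to park. In a random assignment of $m$ drivers to $n$ spaces, $f$ is uniformly distributed over all $n^m$ maps $\{1,\dots,m\}\to\{1,\dots,n\}$. For integers $n,m,k\ge 0$ put $$S(n,m,k)=\begin{cases} n^m & \text{if } k\le m-n,\\ \displaystyle\sum_{i=0}^{m-k}\binom{m}{i}\,(n-m+k)\,(n-m+k+i)^{i-1}\,(m-k-i)^{m-i} & \text{otherwise,}\end{cases}$$ where $0^0=1$ and the sum is empty if $k>m$. **Corollary.** Let $k\colon\mathbb N\to\mathbb N$, and let $p_n$ be the probability that in a random assignment of $n$ drivers to $n$ spaces at least $k(n)$ drivers fail to park. Then $$\lim_{n\to\infty}p_n=\lim_{n\to\infty}\frac{S(n,n,k(n))}{n^n}=\begin{cases}0 & \text{if } \lim_{n\to\infty}k(n)/\sqrt n=\infty,\\ 1 & \text{if } \lim_{n\to\infty}k(n)/\sqrt n=0.\end{cases}$$ -/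

import Mathlib

open Filter Topology

namespace Parking

/-- The free spaces that a driver with preferred space `a` can still reach when the set of
occupied spaces is `occ`: the unoccupied spaces whose number is at least `a`. -/
def reachable {n : ℕ} (occ : Finset (Fin n)) (a : Fin n) : Finset (Fin n) :=
  Finset.univ.filter (fun j => a ≤ j ∧ j ∉ occ)

/-- The arrival of one driver with preferred space `a`. The state is the pair consisting of the set
of occupied spaces and the number of drivers who have left without parking. The driver takes the
first free space with number at least `a`, and leaves if there is none. -/
def arrive {n : ℕ} (s : Finset (Fin n) × ℕ) (a : Fin n) : Finset (Fin n) × ℕ :=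
  if h : (reachable s.1 a).Nonempty then (insert ((reachable s.1 a).min' h) s.1, s.2)
  else (s.1, s.2 + 1)

/-- The number of drivers who fail to park when `m` drivers with preferences
`f 0, …, f (m - 1)` arrive in this order at an empty car park with `n` spaces. -/
def defect {n m : ℕ} (f : Fin m → Fin n) : ℕ :=
  ((List.ofFn f).foldl arrive (∅, 0)).2

/-- The probability that at least `k` drivers fail to park in an assignment of `m` drivers
to `n` spaces chosen uniformly among all `n ^ m` assignments. -/
noncomputable def probDefectGE (n m k : ℕ) : ℝ :=
  (ProbabilityTheory.uniformOn (Set.univ : Set (Fin m → Fin n))).real {f | k ≤ defect f}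

/-- The sum `S(n, m, k)`. It equals `n ^ m` if `k ≤ m - n` (in the integers), and otherwise it is
the sum over the integers `i` with `0 ≤ i ≤ m - k` (an empty sum if `k > m`); the exponent
`i - 1` is an integer, equal to `-1` for `i = 0`. -/
noncomputable def S (n m k : ℕ) : ℝ :=
  if (k : ℤ) ≤ (m : ℤ) - (n : ℤ) then (n : ℝ) ^ m
  else ∑ i ∈ Finset.range (m + 1 - k),
    (m.choose i : ℝ) * ((n : ℝ) - m + k) * ((n : ℝ) - m + k + i) ^ ((i : ℤ) - 1)
      * ((m : ℝ) - k - i) ^ (m - i)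

end Parking

/-!
The defect of an assignment is the largest excess, over all final blocks of spaces, of the number of
drivers who prefer the block over its length (`le_defect_iff_exceeds`). This no longer depends on the
order of arrival, so the assignments with defect at least `k` can be counted by removing the first
space together with the drivers who prefer it. The resulting recursion `overflowCount_succ` carries
the rest of the argument.

* The sum `S n m k` satisfies the same recursion, by the binomial theorem and its derivative, so the
  probability is exactly `S n m k / n ^ m` (`S_eq_overflowCount`).
* In the number `m` of drivers who prefer one of the last `n` spaces, `(1 + k / n) ^ m` is a
  martingale as `n` decreases. It is at least `(1 + k / N) ^ (N + k)` once the excess `m - n` has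
  reached `k`, and it starts at `(1 + k / N) ^ N` for `N` drivers and `N` spaces. Hence the
  probability of a defect of at least `k` is at most `(1 + k / N) ^ (-k) ≤ 1 / (1 + k ^ 2 / N)`,
  which settles the case `k / √N → ∞` (`probDefectGE_mul_le_one`).
* If the defect is less than `k`, the excess over the last half of the spaces is less than `k`.
  Either it lies in `(-L, k)`, which has probability at most `3 (k + L) / √N` because every value of
  this binomial variable has probability at most `3 / √N`; or it is at most `-L` although no excess
  has reached `k`, which has probability at most `k / L` by the martingale property of `m / n`
  (`pow_sub_overflowCount_le`). With `L = √(k √N)` both bounds tend to `0` if `k / √N → 0`.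
-/

namespace Parking

/-! ### The defect as a maximal excess of demand -/

/-- The invariant of the parking process. After the drivers in `l` have arrived, those who prefer a
space `≥ j` either occupy one of the spaces `≥ j` or have left; and if the space just before `j` is
still free (or `j = 0`), then no other driver has crossed it, so that equality holds. -/
lemma foldl_arrive_invariant {n : ℕ} (l : List (Fin n)) :
    (∀ j : ℕ, l.countP (fun a : Fin n => decide (j ≤ (a : ℕ))) ≤
      ((l.foldl arrive (∅, 0)).1.filter (fun x : Fin n => j ≤ (x : ℕ))).card
        + (l.foldl arrive (∅, 0)).2) ∧
    (∀ j : ℕ, j ≤ n → (∀ x : Fin n, (x : ℕ) + 1 = j → x ∉ (l.foldl arrive (∅, 0)).1) →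
      l.countP (fun a : Fin n => decide (j ≤ (a : ℕ))) =
      ((l.foldl arrive (∅, 0)).1.filter (fun x : Fin n => j ≤ (x : ℕ))).card
        + (l.foldl arrive (∅, 0)).2) := by
  induction l using List.reverseRecOn with
  | nil => simp
  | append_singleton l a ih =>
    rw [List.foldl_append, List.foldl_cons, List.foldl_nil]
    generalize l.foldl arrive (∅, 0) = s at ih
    obtain ⟨occ, lost⟩ := s
    obtain ⟨ih1, ih2⟩ := ih
    simp only at ih1 ih2
    simp only [List.countP_append, List.countP_singleton, decide_eq_true_eq]
    unfold arrive
    by_cases h : (reachable occ a).Nonempty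
    · rw [dif_pos h]
      simp only
      set p := (reachable occ a).min' h with hp
      have hpm : p ∈ reachable occ a := Finset.min'_mem _ _
      have hpa : a ≤ p ∧ p ∉ occ := by simpa [reachable] using hpm
      have hap : (a : ℕ) ≤ p := hpa.1
      have hcard (j : ℕ) : ((insert p occ).filter (fun x : Fin n => j ≤ (x : ℕ))).card =
          (occ.filter (fun x : Fin n => j ≤ (x : ℕ))).card + if j ≤ (p : ℕ) then 1 else 0 := by
        rw [Finset.filter_insert]
        split_ifs
        · rw [Finset.card_insert_of_notMem (by simp [hpa.2])]
        · rfl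
      refine ⟨fun j => ?_, fun j hj hfree => ?_⟩
      · rw [hcard]
        have := ih1 j
        split_ifs <;> omega
      · rw [hcard]
        have h2 := ih2 j hj (fun x hx hxo => hfree x hx (Finset.mem_insert_of_mem hxo))
        have h3 : j ≤ (a : ℕ) ↔ j ≤ (p : ℕ) := by
          refine ⟨fun h => h.trans hap, fun hjp => ?_⟩
          by_contra hja
          have hx := hfree ⟨j - 1, by omega⟩ (by simp; omega)
          have hxr : (⟨j - 1, by omega⟩ : Fin n) ∈ reachable occ a := by
            simp only [reachable, Finset.mem_filter, Finset.mem_univ, true_and, Fin.le_def]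
            exact ⟨by omega, fun hxo => hx (Finset.mem_insert_of_mem hxo)⟩
          have := Finset.min'_le _ _ hxr
          rw [← hp, Fin.le_def] at this
          simp only at this
          omega
        simp only [h3]
        omega
    · rw [dif_neg h]
      simp only
      refine ⟨fun j => ?_, fun j hj hfree => ?_⟩
      · have := ih1 j
        split_ifs <;> omega
      · have h2 := ih2 j hj hfree
        have h3 : j ≤ (a : ℕ) := by
          by_contra hja
          refine h ⟨⟨j - 1, by omega⟩, ?_⟩
          simp only [reachable, Finset.mem_filter, Finset.mem_univ, true_and, Fin.le_def]
          exact ⟨by omega, hfree _ (by simp; omega)⟩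
        rw [if_pos h3]
        omega

/-- The assignment `f` of the drivers in `α` to `n` spaces *exceeds by `k`* if, for some `j`, the
last `n - j` spaces are preferred by at least `n - j + k` drivers. Spaces are numbered from `0`, and
`j = n` (no space at all) is allowed. -/
def Exceeds {α : Type*} [Fintype α] {n : ℕ} (k : ℕ) (f : α → Fin n) : Prop :=
  ∃ j ≤ n, n - j + k ≤ (Finset.univ.filter (fun i => j ≤ (f i : ℕ))).card

lemma countP_ofFn_eq_card {n m : ℕ} (f : Fin m → Fin n) (j : ℕ) :
    (List.ofFn f).countP (fun a : Fin n => decide (j ≤ (a : ℕ))) =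
      (Finset.univ.filter (fun i => j ≤ (f i : ℕ))).card := by
  rw [List.ofFn_eq_map, List.countP_map, List.countP_eq_length_filter]
  rfl

lemma card_filter_le_val {n : ℕ} (j : ℕ) :
    (Finset.univ.filter (fun x : Fin n => j ≤ (x : ℕ))).card = n - j := by
  induction n generalizing j with
  | zero => simp
  | succ n ih => 
    rw [Fin.card_filter_univ_succ]
    cases j with
    | zero => simp
    | succ j => simpa using ih j

theorem le_defect_iff_exceeds {n m : ℕ} (k : ℕ) (f : Fin m → Fin n) :
    k ≤ defect f ↔ Exceeds k f := by
  obtain ⟨h1, h2⟩ := foldl_arrive_invariant (List.ofFn f)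
  simp only [countP_ofFn_eq_card] at h1 h2
  unfold defect Exceeds
  set s := (List.ofFn f).foldl arrive (∅, 0)
  constructor
  · intro hk
    -- `j` is the start of the final block of occupied spaces
    have hex : ∃ j, j ≤ n ∧ ∀ x : Fin n, j ≤ (x : ℕ) → x ∈ s.1 :=
      ⟨n, le_rfl, fun x hx => absurd x.2 (by omega)⟩
    classical
    obtain ⟨hjn, hj⟩ := Nat.find_spec hex
    refine ⟨Nat.find hex, hjn, ?_⟩
    rw [h2 _ hjn]
    · have : s.1.filter (fun x : Fin n => Nat.find hex ≤ (x : ℕ)) =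
          Finset.univ.filter (fun x : Fin n => Nat.find hex ≤ (x : ℕ)) := by
        ext x
        simp only [Finset.mem_filter, Finset.mem_univ, true_and, and_iff_right_iff_imp]
        exact hj x
      rw [this, card_filter_le_val]
      omega
    · intro x hx hxs
      refine Nat.find_min hex (m := x) (by omega) ⟨by omega, fun y hy => ?_⟩
      rcases hy.eq_or_lt with h | h
      · rwa [← Fin.ext h]
      · exact hj y (by omega)
  · rintro ⟨j, hj, hc⟩
    have := (h1 j).trans (Nat.add_le_add_right
      ((Finset.card_le_card (Finset.filter_subset_filter _ (Finset.subset_univ _))).trans_eq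
        (card_filter_le_val j)) _)
    omega

/-! ### Counting the assignments by peeling off the first space -/

open Classical in
/-- The number of assignments of `m` drivers to `n` spaces that exceed by `k`, that is, for which
at least `k` drivers fail to park. -/
noncomputable def overflowCount (n m k : ℕ) : ℕ :=
  (Finset.univ.filter (fun f : Fin m → Fin n => Exceeds k f)).card

theorem probDefectGE_eq (n m k : ℕ) :
    probDefectGE n m k = (overflowCount n m k : ℝ) / (n : ℝ) ^ m := by
  classical
  unfold probDefectGE overflowCount
  have : {f : Fin m → Fin n | k ≤ defect f} =
      ↑(Finset.univ.filter (fun f : Fin m → Fin n => Exceeds k f)) := by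
    ext f
    simp [le_defect_iff_exceeds]
  rw [this, MeasureTheory.measureReal_def, ProbabilityTheory.uniformOn_univ,
    MeasureTheory.Measure.count_apply_finset]
  simp

lemma exceeds_comp_equiv {α β : Type*} [Fintype α] [Fintype β] {n k : ℕ} (e : α ≃ β)
    (f : β → Fin n) : Exceeds k (f ∘ e) ↔ Exceeds k f := by
  unfold Exceeds
  have (j : ℕ) : (Finset.univ.filter (fun i => j ≤ ((f ∘ e) i : ℕ))).card =
      (Finset.univ.filter (fun i => j ≤ (f i : ℕ))).card :=
    Finset.card_equiv e (by simp)
  simp only [this]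

open Classical in
lemma card_exceeds (α : Type*) [Fintype α] (n k : ℕ) :
    (Finset.univ.filter (fun f : α → Fin n => Exceeds k f)).card =
      overflowCount n (Fintype.card α) k := by
  refine Finset.card_equiv ((Fintype.equivFin α).arrowCongr (Equiv.refl _)) fun f => ?_
  simp only [Finset.mem_filter, Finset.mem_univ, true_and]
  exact (exceeds_comp_equiv (Fintype.equivFin α).symm f).symm

lemma overflowCount_of_add_le {n m k : ℕ} (h : n + k ≤ m) : overflowCount n m k = n ^ m := by
  classical
  unfold overflowCount
  rw [Finset.filter_true_of_mem]
  · simp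
  · exact fun f _ => ⟨0, by omega, by simpa using h⟩

lemma overflowCount_zero_left {m k : ℕ} (h : m < k) : overflowCount 0 m k = 0 := by
  classical
  unfold overflowCount
  rw [Finset.card_eq_zero, Finset.filter_eq_empty_iff]
  rintro f - ⟨j, -, hj⟩
  have := hj.trans (Finset.card_filter_le _ _)
  simp at this
  omega

/-- If the drivers outside `T` choose among the spaces after the first one and there are too few
drivers for an excess over all spaces together, then the excess is already visible outside `T`. -/
lemma exceeds_peel {α : Type*} [Fintype α] [DecidableEq α] {n k : ℕ} (T : Finset α)
    (h : Fintype.card α ≤ n + k) (f : α → Fin (n + 1)) (g : {x // x ∉ T} → Fin n)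
    (hT : ∀ x ∈ T, f x = 0) (hg : ∀ x : {x // x ∉ T}, f x = (g x).succ) :
    Exceeds k f ↔ Exceeds k g := by
  have hcard (j : ℕ) : (Finset.univ.filter (fun i => j + 1 ≤ (f i : ℕ))).card =
      (Finset.univ.filter (fun i => j ≤ (g i : ℕ))).card := by
    symm
    refine Finset.card_bij (fun x _ => (x : α)) ?_ (fun _ _ _ _ h => Subtype.ext h) ?_
    · intro x hx
      simpa [hg x] using hx
    · intro x hx
      have hxT : x ∉ T := fun hxT => by simp [hT x hxT] at hx
      refine ⟨⟨x, hxT⟩, ?_, rfl⟩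
      have := hg ⟨x, hxT⟩
      simp only at this
      simpa [this] using hx
  constructor
  · rintro ⟨j, hj, hc⟩
    cases j with
    | zero =>
      have := hc.trans (Finset.card_filter_le _ _)
      rw [Finset.card_univ] at this
      omega
    | succ j =>
      rw [hcard] at hc
      exact ⟨j, by omega, by omega⟩
  · rintro ⟨j, hj, hc⟩
    exact ⟨j + 1, by omega, by rw [hcard]; omega⟩

theorem overflowCount_succ {n m k : ℕ} (h : m ≤ n + k) :
    overflowCount (n + 1) m k =
      ∑ c ∈ Finset.range (m + 1), m.choose c * overflowCount n (m - c) k := by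
  classical
  have key (T : Finset (Fin m)) :
      ((Finset.univ.filter (fun f : Fin m → Fin (n + 1) => Exceeds k f)).filter
        (fun f => Finset.univ.filter (fun x => f x = 0) = T)).card =
      overflowCount n (m - T.card) k := by
    have hc : Fintype.card {x // x ∉ T} = m - T.card := by
      simp [Fintype.card_subtype_compl]
    rw [← hc, ← card_exceeds]
    symm
    set F : ({x // x ∉ T} → Fin n) → (Fin m → Fin (n + 1)) :=
      fun g x => if hx : x ∈ T then 0 else (g ⟨x, hx⟩).succ with hF
    have hF0 (g) : ∀ x ∈ T, F g x = 0 := fun x hx => by simp [hF, hx]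
    have hF1 (g) : ∀ x : {x // x ∉ T}, F g x = (g x).succ := fun x => by simp [hF, x.2]
    refine Finset.card_bij (fun g _ => F g) ?_ ?_ ?_
    · intro g hg
      simp only [Finset.mem_filter, Finset.mem_univ, true_and] at hg ⊢
      refine ⟨(exceeds_peel T (by simpa using h) _ g (hF0 g) (hF1 g)).2 hg, ?_⟩
      ext x
      by_cases hx : x ∈ T
      · simp [hx, hF0 g x hx]
      · simp [hx, hF]
    · intro g _ g' _ hgg
      ext x
      have := congrFun hgg x
      rw [hF1, hF1] at this
      rw [Fin.succ_inj.1 this]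
    · intro f hf
      simp only [Finset.mem_filter, Finset.mem_univ, true_and] at hf
      obtain ⟨hf, rfl⟩ := hf
      have hne (x : {x // x ∉ Finset.univ.filter (fun x => f x = 0)}) : f x ≠ 0 := by
        simpa using x.2
      refine ⟨fun x => (f x).pred (hne x), ?_, ?_⟩
      · simp only [Finset.mem_filter, Finset.mem_univ, true_and]
        refine (exceeds_peel _ (by simpa using h) f _ ?_ ?_).1 hf
        · simp
        · simp
      · ext x
        by_cases hx : f x = 0 <;> simp [hF, hx]
  unfold overflowCount
  rw [Finset.card_eq_sum_card_fiberwise (t := (Finset.univ : Finset (Finset (Fin m))))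
    (f := fun f => Finset.univ.filter (fun x => f x = 0)) (by simp [Set.MapsTo])]
  rw [Finset.sum_congr rfl (fun T _ => key T), ← Finset.powerset_univ,
    Finset.sum_powerset_apply_card (fun c => overflowCount n (m - c) k)]
  simp [overflowCount]

lemma overflowCount_zero_right (n m : ℕ) : overflowCount n m 0 = n ^ m := by
  classical
  unfold overflowCount
  rw [Finset.filter_true_of_mem]
  · simp
  · exact fun f _ => ⟨n, le_rfl, by simp⟩

/-! ### Binomial convolutions -/

lemma sum_choose_mul_pow (x : ℝ) (p : ℕ) :
    ∑ c ∈ Finset.range (p + 1), (p.choose c : ℝ) * x ^ (p - c) = (x + 1) ^ p := by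
  rw [add_comm x 1, add_pow]
  exact Finset.sum_congr rfl fun c _ => by ring

lemma sum_choose_mul_derivative_pow (x : ℝ) (p : ℕ) :
    ∑ c ∈ Finset.range (p + 1), (p.choose c : ℝ) * (((p - c : ℕ) : ℝ) * x ^ (p - c - 1)) =
      p * (x + 1) ^ (p - 1) := by
  cases p with
  | zero => simp
  | succ q =>
    rw [Finset.sum_range_succ, Nat.sub_self, Nat.add_sub_cancel, ← sum_choose_mul_pow,
      Finset.mul_sum]
    simp only [Nat.cast_zero, zero_mul, mul_zero, add_zero]
    refine Finset.sum_congr rfl fun c _ => ?_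
    have h := congrArg (Nat.cast : ℕ → ℝ) (Nat.choose_mul_succ_eq q c)
    rw [Nat.cast_mul, Nat.cast_mul] at h
    rw [show q + 1 - c - 1 = q - c by omega, ← mul_assoc, ← h]
    ring

/-- Splitting off first `c` and then `r` of `m` objects, or the other way round. -/
lemma sum_choose_sum_choose_comm (m : ℕ) (u : ℕ → ℝ) (v : ℕ → ℕ → ℝ) :
    ∑ c ∈ Finset.range (m + 1), (m.choose c : ℝ) *
      ∑ r ∈ Finset.range (m - c + 1), ((m - c).choose r : ℝ) * u r * v r (m - c - r) =
    ∑ r ∈ Finset.range (m + 1), (m.choose r : ℝ) * u r *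
      ∑ c ∈ Finset.range (m - r + 1), ((m - r).choose c : ℝ) * v r (m - r - c) := by
  simp only [Finset.mul_sum]
  rw [Finset.sum_comm' (t' := Finset.range (m + 1)) (s' := fun r => Finset.range (m - r + 1))
    (by intro c r; simp only [Finset.mem_range]; omega)]
  refine Finset.sum_congr rfl fun r hr => Finset.sum_congr rfl fun c hc => ?_
  have h1 : m.choose c * (m - c).choose r = m.choose r * (m - r).choose c := by
    have h2 := Nat.choose_mul (n := m) (k := c + r) (s := c) (by omega)
    have h3 := Nat.choose_mul (n := m) (k := c + r) (s := r) (by omega)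
    rw [Nat.add_sub_cancel_left] at h2
    rw [Nat.add_sub_cancel] at h3
    rw [← h2, ← h3, Nat.choose_symm_add]
  have h4 := congrArg (Nat.cast : ℕ → ℝ) h1
  rw [Nat.cast_mul, Nat.cast_mul] at h4
  rw [show m - c - r = m - r - c by omega]
  linear_combination (u r * v r (m - r - c)) * h4

lemma overflowCount_succ_cast {n m k : ℕ} (h : m ≤ n + k) :
    (overflowCount (n + 1) m k : ℝ) =
      ∑ c ∈ Finset.range (m + 1), (m.choose c : ℝ) * (overflowCount n (m - c) k : ℝ) := by
  rw [overflowCount_succ h]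
  push_cast
  rfl

/-! ### The exact count of the assignments with large defect -/

/-- The polynomial `x ^ i - i * x ^ (i - 1) = (x - i) * x ^ (i - 1)`, equal to `1` for `i = 0`. For
integers `x ≥ max i 1` it is the number of assignments of `i` drivers to `x - 1` spaces for which
every driver parks. -/
noncomputable def parkingPoly (x : ℝ) (i : ℕ) : ℝ := x ^ i - i * x ^ (i - 1)

lemma sum_choose_mul_parkingPoly (x : ℝ) (p : ℕ) :
    ∑ c ∈ Finset.range (p + 1), (p.choose c : ℝ) * parkingPoly x (p - c) =
      parkingPoly (x + 1) p := by
  simp only [parkingPoly, mul_sub, Finset.sum_sub_distrib]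
  rw [sum_choose_mul_pow, sum_choose_mul_derivative_pow]

lemma parkingPoly_self {i : ℕ} (hi : i ≠ 0) : parkingPoly i i = 0 := by
  rw [parkingPoly, mul_pow_sub_one hi, sub_self]

/-- For `m < n + k`, consider the longest final block of spaces preferred by exactly `k` more drivers
than it has spaces, if there is one. It is preceded by a space that stays free; `r` is the number of
drivers who prefer that block of `r - k` spaces, and the other `m - r` drivers all park before the
free space. The proof only checks that the right-hand side satisfies the recursion
`overflowCount_succ`. -/
theorem overflowCount_eq_sum {n m k : ℕ} (h : m ≤ n + k) :
    (overflowCount n m k : ℝ) = ∑ r ∈ Finset.range (m + 1), (m.choose r : ℝ) *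
      (if k ≤ r then ((r : ℝ) - k) ^ r else 0) * parkingPoly ((n : ℝ) + k - r) (m - r) := by
  induction n generalizing m with
  | zero =>
    rcases h.eq_or_lt with rfl | h
    · rw [overflowCount_of_add_le le_rfl, Finset.sum_range_succ, Finset.sum_eq_zero]
      · simp [parkingPoly]
      · intro r hr
        simp only [Finset.mem_range] at hr
        simp [show ¬ k ≤ r by omega]
    · rw [overflowCount_zero_left (by omega), Finset.sum_eq_zero]
      · simp
      · intro r hr
        simp only [Finset.mem_range] at hr
        simp [show ¬ k ≤ r by omega]
  | succ n ih =>
    rcases h.eq_or_lt with rfl | h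
    · rw [overflowCount_of_add_le le_rfl, Finset.sum_range_succ, Finset.sum_eq_zero]
      · simp [parkingPoly]
      · intro r hr
        simp only [Finset.mem_range] at hr
        have := parkingPoly_self (i := n + 1 + k - r) (by omega)
        rw [Nat.cast_sub hr.le] at this
        push_cast at this ⊢
        rw [this, mul_zero]
    · rw [overflowCount_succ_cast (by omega)]
      have hc (c : ℕ) := ih (m := m - c) (by omega)
      simp only [hc]
      rw [sum_choose_sum_choose_comm m (fun r => if k ≤ r then ((r : ℝ) - k) ^ r else 0)
        (fun r i => parkingPoly ((n : ℝ) + k - r) i)]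
      refine Finset.sum_congr rfl fun r _ => ?_
      rw [sum_choose_mul_parkingPoly]
      push_cast
      ring_nf

theorem S_eq_overflowCount (n m k : ℕ) : S n m k = overflowCount n m k := by
  unfold S
  split_ifs with h
  · rw [overflowCount_of_add_le (by omega)]
    push_cast
    rfl
  · have hnm : m < n + k := by omega
    rw [overflowCount_eq_sum hnm.le, ← Finset.sum_range_reflect _ (m + 1)]
    rw [← Finset.sum_subset (Finset.range_mono (show m + 1 - k ≤ m + 1 by omega))]
    · refine Finset.sum_congr rfl fun i hi => ?_
      simp only [Finset.mem_range] at hi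
      rw [Nat.add_sub_cancel, if_pos (by omega), Nat.choose_symm (by omega),
        Nat.sub_sub_self (by omega), Nat.cast_sub (by omega)]
      have hpos : (0 : ℝ) < n - m + k := by
        have : (m : ℝ) < n + k := by exact_mod_cast hnm
        linarith
      have hP : parkingPoly ((n : ℝ) + k - (m - i)) i =
          ((n : ℝ) - m + k) * ((n : ℝ) - m + k + i) ^ ((i : ℤ) - 1) := by
        rw [show (n : ℝ) + k - (m - i) = n - m + k + i by ring]
        cases i with
        | zero => simp [parkingPoly, hpos.ne']
        | succ i =>
          rw [parkingPoly, show ((i + 1 : ℕ) : ℤ) - 1 = (i : ℤ) by push_cast; ring, zpow_natCast,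
            Nat.add_sub_cancel]
          push_cast
          ring
      rw [hP, show (m : ℝ) - i - k = m - k - i by ring]
      ring
    · intro i hi hi'
      simp only [Finset.mem_range] at hi hi'
      rw [if_neg (by omega)]
      ring

theorem probDefectGE_eq_S_div (n m k : ℕ) : probDefectGE n m k = S n m k / (n : ℝ) ^ m := by
  rw [probDefectGE_eq, S_eq_overflowCount]

/-! ### The upper bound for the probability of a large defect -/

/-- The function `x ↦ (1 + k / x) ^ (x + k)` is antitone. -/
lemma one_add_div_pow_antitone {n N k : ℕ} (hn : 1 ≤ n) (hN : n ≤ N) :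
    (1 + (k : ℝ) / N) ^ (N + k) ≤ (1 + (k : ℝ) / n) ^ (n + k) := by
  have hn0 : (0 : ℝ) < n := by exact_mod_cast hn
  have hN0 : (0 : ℝ) < N := by exact_mod_cast hn.trans hN
  have hnN : (n : ℝ) ≤ N := by exact_mod_cast hN
  have hk : (0 : ℝ) ≤ k := Nat.cast_nonneg k
  have hnk : (0 : ℝ) < n + k := by linarith
  have hNk : (0 : ℝ) < N + k := by linarith
  -- Bernoulli's inequality for the reciprocals, with the exponent `(n + k) / (N + k) ≤ 1`
  have hB := rpow_one_add_le_one_add_mul_self (s := -((k : ℝ) / (n + k)))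
    (by rw [neg_le_neg_iff, div_le_one hnk]; linarith)
    (p := ((n : ℝ) + k) / (N + k)) (by positivity) (by rw [div_le_one hNk]; linarith)
  rw [show 1 + -((k : ℝ) / (n + k)) = n / (n + k) by field_simp; ring,
    show 1 + ((n : ℝ) + k) / (N + k) * -((k : ℝ) / (n + k)) = N / (N + k) by field_simp; ring] at hB
  have h2 := pow_le_pow_left₀ (by positivity) hB (N + k)
  rw [← Real.rpow_natCast (((n : ℝ) / (n + k)) ^ _), ← Real.rpow_mul (by positivity)] at h2
  push_cast at h2
  rw [div_mul_cancel₀ _ hNk.ne'] at h2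
  have h3 : ((n : ℝ) / (n + k)) ^ (n + k) ≤ ((N : ℝ) / (N + k)) ^ (N + k) := by
    rw [← Real.rpow_natCast]
    push_cast
    exact h2
  have h4 := inv_anti₀ (by positivity) h3
  rw [← inv_pow, ← inv_pow, inv_div, inv_div, add_div, add_div, div_self hn0.ne',
    div_self hN0.ne'] at h4
  exact h4

/-- A maximal inequality: in the number `m` of drivers who prefer one of the last `n` spaces,
`(1 + k / n) ^ m` is a martingale, and it is at least `(1 + k / N) ^ (N + k)` when `m ≥ n + k`. -/
lemma overflowCount_mul_le {N k : ℕ} (hk : 1 ≤ k) {n m : ℕ} (hn : n ≤ N) :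
    (overflowCount n m k : ℝ) * (1 + (k : ℝ) / N) ^ (N + k) ≤ ((n : ℝ) + k) ^ m := by
  induction n generalizing m with
  | zero =>
    have : overflowCount 0 m k = 0 := by
      rcases lt_or_ge m k with h | h
      · exact overflowCount_zero_left h
      · rw [overflowCount_of_add_le (by omega), zero_pow (by omega)]
    rw [this, Nat.cast_zero, zero_mul]
    positivity
  | succ n ih =>
    rcases lt_or_ge m (n + 1 + k) with h | h
    · rw [overflowCount_succ_cast (by omega), Finset.sum_mul]
      calc _ ≤ ∑ c ∈ Finset.range (m + 1), (m.choose c : ℝ) * ((n : ℝ) + k) ^ (m - c) := by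
            refine Finset.sum_le_sum fun c _ => ?_
            rw [mul_assoc]
            exact mul_le_mul_of_nonneg_left (ih (by omega)) (Nat.cast_nonneg _)
        _ = _ := by
            rw [sum_choose_mul_pow]
            push_cast
            ring_nf
    · rw [overflowCount_of_add_le h]
      have hle : (1 + (k : ℝ) / N) ^ (N + k) ≤ (1 + (k : ℝ) / (n + 1 : ℕ)) ^ m :=
        (one_add_div_pow_antitone (by omega) hn).trans
          (pow_le_pow_right₀ (by simp; positivity) h)
      rw [Nat.cast_pow]
      refine (mul_le_mul_of_nonneg_left hle (by positivity)).trans_eq ?_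
      rw [← mul_pow]
      congr 1
      field_simp

theorem probDefectGE_mul_le_one {n k : ℕ} (hn : 1 ≤ n) :
    probDefectGE n n k * (1 + ((k : ℝ) / √n) ^ 2) ≤ 1 := by
  have hn0 : (0 : ℝ) < n := by exact_mod_cast hn
  rw [probDefectGE_eq, div_pow, Real.sq_sqrt hn0.le]
  rcases Nat.eq_zero_or_pos k with rfl | hk
  · rw [overflowCount_zero_right]
    simp [hn0.ne']
  · have h := overflowCount_mul_le hk (le_refl n) (m := n)
    rw [show (n : ℝ) + k = n * (1 + k / n) by field_simp, mul_pow, pow_add,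
      mul_comm ((1 + (k : ℝ) / n) ^ n), ← mul_assoc] at h
    have h2 := le_of_mul_le_mul_right h (by positivity)
    have hB : 1 + (k : ℝ) ^ 2 / n ≤ (1 + (k : ℝ) / n) ^ k := by
      have hnonneg : (0 : ℝ) ≤ k / n := by positivity
      refine le_trans (le_of_eq ?_) (one_add_mul_le_pow (by linarith) k)
      ring
    rw [div_mul_eq_mul_div, div_le_one (by positivity)]
    exact (mul_le_mul_of_nonneg_left hB (Nat.cast_nonneg _)).trans h2

/-! ### The lower bound for the probability of a large defect -/

open Classical in
/-- A bound for the number of assignments that do not exceed by `k`. The excess over the last `h`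
spaces, for uniform preferences, lies in the window `(-L, k)`, which is counted by the sum, or it is
at most `-L`. Now `k` minus `h / n` times the excess over the last `n` spaces is a martingale in
decreasing `n`, nonnegative for as long as the excess is at most `k`; so Markov's inequality bounds
the second case. -/
lemma pow_sub_overflowCount_le {h k : ℕ} (hh : 1 ≤ h) {L : ℝ} (hL : 0 < L) {n : ℕ} (hn : h ≤ n)
    {m : ℕ} (hm : m ≤ n + k) :
    (n : ℝ) ^ m - overflowCount n m k ≤
      ∑ j ∈ Finset.range (m + 1), (m.choose j : ℝ) *
        ((if (h : ℝ) - L < j ∧ (j : ℝ) < h + k then 1 else 0) * (h : ℝ) ^ j) *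
          ((n : ℝ) - h) ^ (m - j) +
      (((k : ℝ) + h) * (n : ℝ) ^ m - h * (m * (n : ℝ) ^ (m - 1))) / L := by
  have hh0 : (0 : ℝ) < h := by exact_mod_cast hh
  induction n, hn using Nat.le_induction generalizing m with
  | base =>
    have hsum : ∑ j ∈ Finset.range (m + 1), (m.choose j : ℝ) *
        ((if (h : ℝ) - L < j ∧ (j : ℝ) < h + k then 1 else 0) * (h : ℝ) ^ j) *
          ((h : ℝ) - h) ^ (m - j) =
        (if (h : ℝ) - L < m ∧ (m : ℝ) < h + k then 1 else 0) * (h : ℝ) ^ m := by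
      rw [Finset.sum_range_succ, Finset.sum_eq_zero]
      · simp
      · intro j hj
        simp only [Finset.mem_range] at hj
        rw [sub_self, zero_pow (by omega), mul_zero]
    have hlin : ((k : ℝ) + h) * (h : ℝ) ^ m - h * (m * (h : ℝ) ^ (m - 1)) =
        (k + h - m) * (h : ℝ) ^ m := by
      cases m with
      | zero => simp
      | succ m =>
        rw [Nat.add_sub_cancel]
        ring
    rw [hsum, hlin]
    have hpow : (0 : ℝ) < (h : ℝ) ^ m := by positivity
    rcases hm.eq_or_lt with rfl | hm
    · rw [overflowCount_of_add_le le_rfl, if_neg (by push_cast; simp)]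
      push_cast
      apply le_of_eq
      ring
    · have hm' : (m : ℝ) < h + k := by exact_mod_cast hm
      have hD : (0 : ℝ) ≤ overflowCount h m k := Nat.cast_nonneg _
      by_cases hj : (h : ℝ) - L < m
      · rw [if_pos ⟨hj, hm'⟩]
        have : 0 ≤ ((k : ℝ) + h - m) * (h : ℝ) ^ m / L :=
          div_nonneg (mul_nonneg (by linarith) hpow.le) hL.le
        linarith
      · rw [if_neg (fun h => hj h.1)]
        have hk : (0 : ℝ) ≤ k := Nat.cast_nonneg k
        have : (h : ℝ) ^ m ≤ ((k : ℝ) + h - m) * (h : ℝ) ^ m / L := by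
          rw [le_div_iff₀ hL, mul_comm]
          exact mul_le_mul_of_nonneg_right (by linarith) hpow.le
        linarith
  | succ n hn ih =>
    have hnh : (h : ℝ) ≤ n := by exact_mod_cast hn
    have hk : (0 : ℝ) ≤ k := Nat.cast_nonneg k
    rcases hm.eq_or_lt with rfl | hm
    · rw [overflowCount_of_add_le le_rfl, Nat.cast_pow, sub_self]
      refine add_nonneg (Finset.sum_nonneg fun j _ => mul_nonneg ?_ (pow_nonneg ?_ _))
        (div_nonneg ?_ hL.le)
      · split_ifs <;> positivity
      · push_cast
        linarith
      · rw [show n + 1 + k - 1 = n + k by omega, show n + 1 + k = (n + k) + 1 by ring, pow_succ]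
        push_cast
        have : 0 ≤ ((n : ℝ) + 1) ^ (n + k) * (k * (n + 1 - h)) :=
          mul_nonneg (by positivity) (mul_nonneg hk (by linarith))
        nlinarith
    · have hc : ((n + 1 : ℕ) : ℝ) ^ m - overflowCount (n + 1) m k =
          ∑ c ∈ Finset.range (m + 1), (m.choose c : ℝ) *
            ((n : ℝ) ^ (m - c) - overflowCount n (m - c) k) := by
        simp only [mul_sub, Finset.sum_sub_distrib]
        rw [sum_choose_mul_pow, overflowCount_succ_cast (by omega)]
        push_cast
        rfl
      rw [hc]
      refine (Finset.sum_le_sum fun c _ => mul_le_mul_of_nonneg_left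
        (ih (m := m - c) (by omega)) (Nat.cast_nonneg _)).trans_eq ?_
      simp only [mul_add, Finset.sum_add_distrib]
      congr 1
      · rw [sum_choose_sum_choose_comm m
          (fun j => (if (h : ℝ) - L < j ∧ (j : ℝ) < h + k then 1 else 0) * (h : ℝ) ^ j)
          (fun _ i => ((n : ℝ) - h) ^ i)]
        refine Finset.sum_congr rfl fun j _ => ?_
        rw [sum_choose_mul_pow]
        push_cast
        ring_nf
      · push_cast
        rw [← sum_choose_mul_pow, ← sum_choose_mul_derivative_pow, Finset.mul_sum, Finset.mul_sum,
          ← Finset.sum_sub_distrib, Finset.sum_div]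
        exact Finset.sum_congr rfl fun c _ => by ring

lemma centralBinom_sq_mul_le (n : ℕ) : n.centralBinom ^ 2 * (2 * n + 1) ≤ 16 ^ n := by
  induction n with
  | zero => simp
  | succ n ih =>
    have h := Nat.succ_mul_centralBinom_succ n
    refine le_of_mul_le_mul_left (a := (n + 1) ^ 2) ?_ (pow_pos n.succ_pos 2)
    calc (n + 1) ^ 2 * ((n + 1).centralBinom ^ 2 * (2 * (n + 1) + 1))
        = ((n + 1) * (n + 1).centralBinom) ^ 2 * (2 * n + 3) := by ring
      _ = (n.centralBinom ^ 2 * (2 * n + 1)) * (4 * (2 * n + 1) * (2 * n + 3)) := by rw [h]; ring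
      _ ≤ 16 ^ n * (16 * (n + 1) ^ 2) := Nat.mul_le_mul ih (by nlinarith)
      _ = _ := by ring

lemma choose_sq_mul_le (n j : ℕ) : n.choose j ^ 2 * n ≤ 4 ^ n := by
  refine (Nat.mul_le_mul_right n (Nat.pow_le_pow_left (Nat.choose_le_middle j n) 2)).trans ?_
  obtain ⟨a, rfl | rfl⟩ := n.even_or_odd'
  · rw [Nat.mul_div_cancel_left a two_pos, pow_mul]
    exact (Nat.mul_le_mul_left _ (Nat.le_succ _)).trans (centralBinom_sq_mul_le a)
  · rw [show (2 * a + 1) / 2 = a by omega]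
    -- the middle coefficient of odd order is half of the next central one
    have h1 : (a + 1).centralBinom = 2 * (2 * a + 1).choose a := by
      rw [Nat.centralBinom_eq_two_mul_choose, show 2 * (a + 1) = (2 * a + 1) + 1 by ring,
        Nat.choose_succ_succ, ← Nat.choose_symm_half a]
      ring
    have h2 := centralBinom_sq_mul_le (a + 1)
    rw [h1] at h2
    have h3 : (16 : ℕ) ^ (a + 1) = 4 * 4 ^ (2 * a + 1) := by
      rw [show (16 : ℕ) = 4 ^ 2 by norm_num, ← pow_mul]
      ring
    nlinarith [Nat.zero_le ((2 * a + 1).choose a ^ 2)]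

lemma choose_le_two_pow_div_sqrt {n : ℕ} (hn : 1 ≤ n) (j : ℕ) :
    (n.choose j : ℝ) ≤ 2 ^ n / √n := by
  have hn0 : (0 : ℝ) < n := by exact_mod_cast hn
  rw [le_div_iff₀ (Real.sqrt_pos.2 hn0)]
  refine le_of_sq_le_sq ?_ (by positivity)
  rw [mul_pow, Real.sq_sqrt hn0.le, ← pow_mul, mul_comm n 2, pow_mul]
  norm_num
  exact_mod_cast choose_sq_mul_le n j

/-- The probability that a given set of about half of the `n` spaces is preferred by exactly `j`
drivers is at most `3 / √n`. -/
lemma choose_mul_half_pow_le {n j : ℕ} (hn : 1 ≤ n) (hj : j ≤ n) :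
    (n.choose j : ℝ) * (((n / 2 : ℕ) : ℝ) ^ j * ((n : ℝ) - (n / 2 : ℕ)) ^ (n - j)) ≤
      3 * (n : ℝ) ^ n / √n := by
  have hn0 : (0 : ℝ) < n := by exact_mod_cast hn
  have h1 : ((n / 2 : ℕ) : ℝ) ≤ (n + 1) / 2 := by
    have : 2 * (n / 2) ≤ n := by omega
    have : 2 * ((n / 2 : ℕ) : ℝ) ≤ n := by exact_mod_cast this
    linarith
  have h1' : 0 ≤ (n : ℝ) - (n / 2 : ℕ) := by
    have : n / 2 ≤ n := by omega
    have : ((n / 2 : ℕ) : ℝ) ≤ n := by exact_mod_cast this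
    linarith
  have h2 : (n : ℝ) - (n / 2 : ℕ) ≤ (n + 1) / 2 := by
    have : n ≤ 2 * (n / 2) + 1 := by omega
    have : (n : ℝ) ≤ 2 * ((n / 2 : ℕ) : ℝ) + 1 := by exact_mod_cast this
    linarith
  have h3 : ((n / 2 : ℕ) : ℝ) ^ j * ((n : ℝ) - (n / 2 : ℕ)) ^ (n - j) ≤ (((n : ℝ) + 1) / 2) ^ n := by
    calc _ ≤ (((n : ℝ) + 1) / 2) ^ j * (((n : ℝ) + 1) / 2) ^ (n - j) := by gcongr
      _ = _ := by rw [← pow_add, Nat.add_sub_cancel' hj]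
  have h4 : ((n : ℝ) + 1) ^ n ≤ 3 * (n : ℝ) ^ n := by
    have h5 : (1 + 1 / (n : ℝ)) ^ n ≤ 3 := by
      calc (1 + 1 / (n : ℝ)) ^ n ≤ Real.exp (1 / n) ^ n := by
            gcongr
            linarith [Real.add_one_le_exp (1 / (n : ℝ))]
        _ = Real.exp 1 := by rw [← Real.exp_nat_mul, mul_one_div_cancel hn0.ne']
        _ ≤ 3 := Real.exp_one_lt_three.le
    calc ((n : ℝ) + 1) ^ n = (1 + 1 / (n : ℝ)) ^ n * (n : ℝ) ^ n := by
          rw [← mul_pow]; congr 1; field_simp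
      _ ≤ _ := by gcongr
  calc _ ≤ 2 ^ n / √n * (((n : ℝ) + 1) / 2) ^ n :=
        mul_le_mul (choose_le_two_pow_div_sqrt hn j) h3 (by positivity) (by positivity)
    _ = ((n : ℝ) + 1) ^ n / √n := by rw [div_pow]; field_simp
    _ ≤ _ := by gcongr

theorem one_sub_probDefectGE_le {n k : ℕ} (hn : 2 ≤ n) {L : ℝ} (hL : 0 < L) :
    1 - probDefectGE n n k ≤ 3 * (k + L) / √n + k / L := by
  classical
  have hn0 : (0 : ℝ) < n := by exact_mod_cast (by omega : 0 < n)
  have hnn : (0 : ℝ) < (n : ℝ) ^ n := by positivity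
  set h := n / 2 with hh
  have key := pow_sub_overflowCount_le (h := h) (k := k) (by omega) hL (n := n) (by omega)
    (m := n) (by omega)
  have hlin : ((k : ℝ) + h) * (n : ℝ) ^ n - h * (n * (n : ℝ) ^ (n - 1)) = k * (n : ℝ) ^ n := by
    rw [mul_pow_sub_one (by omega)]
    ring
  have hsum : ∑ j ∈ Finset.range (n + 1), (n.choose j : ℝ) *
        ((if (h : ℝ) - L < j ∧ (j : ℝ) < h + k then 1 else 0) * (h : ℝ) ^ j) *
          ((n : ℝ) - h) ^ (n - j) ≤ (k + L) * (3 * (n : ℝ) ^ n / √n) := by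
    have hcard : ((((Finset.range (n + 1)).filter
        (fun j : ℕ => (h : ℝ) - L < j ∧ (j : ℝ) < h + k)).card : ℕ) : ℝ) ≤ k + L := by
      have hsub : (Finset.range (n + 1)).filter
          (fun j : ℕ => (h : ℝ) - L < j ∧ (j : ℝ) < h + k) ⊆
          Finset.Ico (h - ⌊L⌋₊) (h + k) := by
        intro j hj
        simp only [Finset.mem_filter, Finset.mem_range, Finset.mem_Ico] at hj ⊢
        refine ⟨?_, by exact_mod_cast hj.2.2⟩
        rw [tsub_le_iff_left, ← tsub_le_iff_right]
        rcases le_total h j with hle | hle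
        · rw [Nat.sub_eq_zero_of_le hle]
          exact Nat.zero_le _
        · refine Nat.le_floor ?_
          rw [Nat.cast_sub hle]
          linarith [hj.2.1]
      have h1 := Finset.card_le_card hsub
      rw [Nat.card_Ico] at h1
      have h2 : ((Finset.range (n + 1)).filter
          (fun j : ℕ => (h : ℝ) - L < j ∧ (j : ℝ) < h + k)).card ≤ k + ⌊L⌋₊ := by omega
      have h3 : ((((Finset.range (n + 1)).filter
        (fun j : ℕ => (h : ℝ) - L < j ∧ (j : ℝ) < h + k)).card : ℕ) : ℝ) ≤ k + (⌊L⌋₊ : ℝ) := by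
        exact_mod_cast h2
      linarith [Nat.floor_le hL.le]
    calc _ = ∑ j ∈ (Finset.range (n + 1)).filter
            (fun j : ℕ => (h : ℝ) - L < j ∧ (j : ℝ) < h + k),
            (n.choose j : ℝ) * ((h : ℝ) ^ j * ((n : ℝ) - h) ^ (n - j)) := by
          rw [Finset.sum_filter]
          refine Finset.sum_congr rfl fun j _ => ?_
          split_ifs <;> ring
      _ ≤ ∑ j ∈ (Finset.range (n + 1)).filter
            (fun j : ℕ => (h : ℝ) - L < j ∧ (j : ℝ) < h + k), 3 * (n : ℝ) ^ n / √n := by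
          refine Finset.sum_le_sum fun j hj => ?_
          simp only [Finset.mem_filter, Finset.mem_range] at hj
          exact choose_mul_half_pow_le (by omega) (by omega)
      _ ≤ _ := by
          rw [Finset.sum_const, nsmul_eq_mul]
          exact mul_le_mul_of_nonneg_right hcard (by positivity)
  rw [hlin] at key
  rw [probDefectGE_eq, one_sub_div hnn.ne', div_le_iff₀ hnn]
  calc _ ≤ (k + L) * (3 * (n : ℝ) ^ n / √n) + k * (n : ℝ) ^ n / L := by linarith
    _ = _ := by ring

lemma probDefectGE_nonneg (n m k : ℕ) : 0 ≤ probDefectGE n m k := by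
  rw [probDefectGE_eq]
  positivity

lemma probDefectGE_self_le_one {n : ℕ} (hn : 1 ≤ n) (k : ℕ) : probDefectGE n n k ≤ 1 := by
  have h := probDefectGE_mul_le_one hn (k := k)
  nlinarith [probDefectGE_nonneg n n k, sq_nonneg ((k : ℝ) / √n)]

/-! ### The two regimes -/

theorem tendsto_probDefectGE_zero {k : ℕ → ℕ}
    (hk : Tendsto (fun n : ℕ => (k n : ℝ) / √(n : ℝ)) atTop atTop) :
    Tendsto (fun n : ℕ => probDefectGE n n (k n)) atTop (𝓝 0) := by
  have h1 : Tendsto (fun n : ℕ => (1 + ((k n : ℝ) / √(n : ℝ)) ^ 2)⁻¹) atTop (𝓝 0) :=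
    tendsto_inv_atTop_zero.comp (tendsto_atTop_add_const_left _ _
      ((tendsto_pow_atTop two_ne_zero).comp hk))
  refine squeeze_zero' (Eventually.of_forall fun n => probDefectGE_nonneg _ _ _) ?_ h1
  filter_upwards [eventually_ge_atTop 1] with n hn
  rw [← one_div, le_div_iff₀ (by positivity)]
  exact probDefectGE_mul_le_one hn

theorem tendsto_probDefectGE_one {k : ℕ → ℕ}
    (hk : Tendsto (fun n : ℕ => (k n : ℝ) / √(n : ℝ)) atTop (𝓝 0)) :
    Tendsto (fun n : ℕ => probDefectGE n n (k n)) atTop (𝓝 1) := by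
  set x : ℕ → ℝ := fun n => (k n : ℝ) / √(n : ℝ) with hx
  have h1 : Tendsto (fun n : ℕ => 3 * x n + 4 * √(x n)) atTop (𝓝 0) := by
    simpa using (hk.const_mul 3).add (hk.sqrt.const_mul 4)
  have h2 : Tendsto (fun n : ℕ => 1 - probDefectGE n n (k n)) atTop (𝓝 0) := by
    refine squeeze_zero' ?_ ?_ h1
    · filter_upwards [eventually_ge_atTop 1] with n hn
      exact sub_nonneg.2 (probDefectGE_self_le_one hn _)
    · filter_upwards [eventually_ge_atTop 2] with n hn
      have hn0 : (0 : ℝ) < n := by exact_mod_cast (by omega : 0 < n)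
      have hs : 0 < √(n : ℝ) := Real.sqrt_pos.2 hn0
      rcases Nat.eq_zero_or_pos (k n) with h0 | hpos
      · rw [probDefectGE_eq, h0, overflowCount_zero_right, Nat.cast_pow, div_self (by positivity),
          sub_self]
        positivity
      · have hxn : 0 < x n := div_pos (by exact_mod_cast hpos) hs
        have hkx : (k n : ℝ) = x n * √n := by simp only [hx]; field_simp
        have hq : 0 < √(x n) := Real.sqrt_pos.2 hxn
        -- the width `√x * √n` balances the two error terms
        refine (one_sub_probDefectGE_le hn (L := √(x n) * √n) (by positivity)).trans_eq ?_
        rw [hkx, ← add_mul, mul_div_mul_right _ _ hs.ne', Real.div_sqrt, ← mul_assoc,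
          mul_div_cancel_right₀ _ hs.ne']
        ring
  simpa using h2.const_sub 1

end Parking

theorem mainTheorem5 (k : ℕ → ℕ) :
    (Tendsto (fun n : ℕ => (k n : ℝ) / Real.sqrt (n : ℝ)) atTop atTop →
      Tendsto (fun n : ℕ => Parking.probDefectGE n n (k n)) atTop (𝓝 0) ∧
      Tendsto (fun n : ℕ => Parking.S n n (k n) / (n : ℝ) ^ n) atTop (𝓝 0)) ∧
    (Tendsto (fun n : ℕ => (k n : ℝ) / Real.sqrt (n : ℝ)) atTop (𝓝 0) →
      Tendsto (fun n : ℕ => Parking.probDefectGE n n (k n)) atTop (𝓝 1) ∧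
      Tendsto (fun n : ℕ => Parking.S n n (k n) / (n : ℝ) ^ n) atTop (𝓝 1)) := by
  simp only [← Parking.probDefectGE_eq_S_div, and_self]
  exact ⟨Parking.tendsto_probDefectGE_zero, Parking.tendsto_probDefectGE_one⟩
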